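/- Let $0<k<1$, $k'=\sqrt{1-k^2}$, $K=\int_0^{\pi/2}du/\sqrt{1-k^2\sin^2u}$, $K'=K(k')$, $\tau=iK'/K$, and let $\theta_1,\dots,\theta_4$ be the Jacobi theta functions with period $\tau$, where $\theta_3(z)=\sum_{n\in\mathbb Z}e^{i\pi(n^2\tau+2nz)}$, $\theta_4(z)=\theta_3(z+\tfrac12)$, $\theta_2(z)=e^{i\pi(\tau/4+z)}\theta_3(z+\tfrac{\tau}2)$, $\theta_1(z)=-\theta_2(z+\tfrac12)$. Let $(x_1,x_2,x_3)\in\mathbb R^3$, $x_4\in\mathbb R$, and let $P_j=(\zeta_j,\eta_j)$, $j=1,\dots,4$, be the four finite solutions (with multiplicity) of $$\eta=(x_2-ix_1)-2x_3\zeta-(x_2+ix_1)\zeta^2,\qquad 0=\eta^2+\tfrac{K^2}{4}\bigl(\zeta^4+2(k^2-k'^2)\zeta^2+1\bigr).$$ Let $\alpha_j=\frac14\int_{\infty_1}^{P_j}d\zeta/\eta$ be their Abel images, where $\infty_1$ is the point at infinity with $\eta/\zeta^2\to-iK/2$ and the paths on the curve are chosen so that $\alpha_1+\alpha_2+\alpha_3+\alpha_4=N\tau$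 with $N\in\mathbb Z$. Put $$\mu_j=\frac14\Bigl\{\frac{\theta_1'(\alpha_j)}{\theta_1(\alpha_j)}+\frac{\theta_3'(\alpha_j)}{\theta_3(\alpha_j)}\Bigr\}+i\pi N-i\bigl[(x_1-ix_2)\zeta_j-ix_3-x_4\bigr].$$ For $z\in(-1,1)$ let $f_3(z)=\frac{\pi\theta_2(0)\theta_4(0)}2\,\frac{\theta_4(z/2)}{\theta_2(z/2)}$, $F=\cosh\bigl(\tfrac12\int_0^zf_3\bigr)$, $G=\sinh\bigl(\tfrac12\int_0^zf_3\bigr)$, $C(z)=\begin{pmatrix}F&G\\G&F\end{pmatrix}$, $\mathcal O=\frac1{\sqrt2}\begin{pmatrix}1&-1\\1&1\end{pmatrix}$. For $i\in\{1,2,3,4\}$, with $(i,j,k,l)$ the cyclic permutation of $(1,2,3,4)$ starting at $i$ (as an index, $k$ is not the modulus), define $$\boldsymbol{\overline v}_i(z)=\bigl(1_2\otimes\mathcal O\,C^{-1}(z)\bigr)\frac{e^{-z\mu_i}}{\theta_2^2(z/2)}\left[\begin{pmatrix}-i\zeta_j\\1\end{pmatrix}\otimes\begin{pmatrix}A\\B\end{pmatrix}+\begin{pmatrix}1\\0\end{pmatrix}\otimes\begin{pmatrix}a\\b\end{pmatrix}\right],$$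 $$A=\frac{\theta_2(\frac z2)\,\theta_2(\alpha_j+\alpha_k+\alpha_l-\frac z2)}{\prod_{s\ne i}\theta_3(\alpha_s)},\qquad B=\frac{\theta_2(\frac z2)\,\theta_4(\alpha_j+\alpha_k+\alpha_l-\frac z2)}{\prod_{s\ne i}\theta_1(\alpha_s)},$$ $$\begin{pmatrix}a\\b\end{pmatrix}=\frac{\theta_2(0)\theta_4(0)\,\theta_3(\alpha_j+\alpha_k)\,\theta_3(\alpha_j+\alpha_l)\,\theta_4(\alpha_k+\alpha_l-\frac z2)}{\prod_{s\ne i}\theta_1(\alpha_s)\theta_3(\alpha_s)}\begin{pmatrix}\theta_4(\alpha_j-\frac z2)/\theta_3(\alpha_j)\\ \theta_2(\alpha_j-\frac z2)/\theta_1(\alpha_j)\end{pmatrix}.$$ Then for every $i$ there are unique vectors $\boldsymbol{\overline v}_{i,s}\in\mathbb C^4$, $s\ge0$, with $\boldsymbol{\overline v}_i(1-\xi)=\sum_{s\ge0}\boldsymbol{\overline v}_{i,s}\,\xi^{s-5/2}$ (convergent) for all sufficiently small $\xi>0$, and, again for all sufficiently small $\xi>0$, $$\boldsymbol{\overline v}_i(-1+\xi)=-\sum_{s\ge0}\boldsymbol{\overline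 v}_{i,s}'\,\xi^{s-5/2},\qquad \boldsymbol{\overline v}_{i,s}'=(-1)^s\,e^{2\mu_i}\left(1_2\otimes\begin{pmatrix}0&1\\-1&0\end{pmatrix}\right)\boldsymbol{\overline v}_{i,s}.$$ -/

import Mathlib

open scoped Kronecker Topology

noncomputable section

namespace Monopole

/-! ### Elliptic parameters and Jacobi theta functions -/

/-- The complete elliptic integral of the first kind, as a function of the modulus `k`. -/
def ellipticK (k : ℝ) : ℝ :=
  ∫ u in (0 : ℝ)..(Real.pi / 2), 1 / Real.sqrt (1 - k ^ 2 * Real.sin u ^ 2)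

/-- The complementary modulus `k'`. -/
def compl (k : ℝ) : ℝ := Real.sqrt (1 - k ^ 2)

/-- The period `τ = i K(k') / K(k)` of the spectral curve. -/
def tau (k : ℝ) : ℂ := Complex.I * (ellipticK (compl k) : ℂ) / (ellipticK k : ℂ)

/-- `θ₃(z) = ∑ₙ exp (iπ (n² τ + 2 n z))`. -/
def theta3 (k : ℝ) (z : ℂ) : ℂ := jacobiTheta₂ z (tau k)

/-- `θ₄(z) = ∑ₙ (-1)ⁿ exp (iπ (n² τ + 2 n z))`. -/
def theta4 (k : ℝ) (z : ℂ) : ℂ := jacobiTheta₂ (z + 1 / 2) (tau k)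

/-- `θ₂(z) = ∑ₙ exp (iπ ((n + 1/2)² τ + 2 (n + 1/2) z))`. -/
def theta2 (k : ℝ) (z : ℂ) : ℂ :=
  Complex.exp (Real.pi * Complex.I * (tau k / 4 + z)) * jacobiTheta₂ (z + tau k / 2) (tau k)

/-- `θ₁(z) = -i ∑ₙ (-1)ⁿ exp (iπ ((n + 1/2)² τ + 2 (n + 1/2) z))`, so that
`θ₂(z ± 1/2) = ∓ θ₁(z)`. -/
def theta1 (k : ℝ) (z : ℂ) : ℂ :=
  -Complex.I * Complex.exp (Real.pi * Complex.I * (tau k / 4 + z)) *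
    jacobiTheta₂ (z + (1 + tau k) / 2) (tau k)

/-! ### The spectral curve, the Atiyah-Ward equation and Abel images -/

/-- The polynomial `η² + (K²/4) (ζ⁴ + 2 (k² - k'²) ζ² + 1)` whose zero set is the spectral
curve of the charge two monopole. -/
def curvePoly (k : ℝ) (ζ η : ℂ) : ℂ :=
  η ^ 2 + (ellipticK k : ℂ) ^ 2 / 4 *
    (ζ ^ 4 + 2 * ((k : ℂ) ^ 2 - (compl k : ℂ) ^ 2) * ζ ^ 2 + 1)

/-- The mini-twistor correspondence: the value of `η` on the twistor line of the point
`(x₁, x₂, x₃)`. -/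
def twistorEta (x₁ x₂ x₃ : ℝ) (ζ : ℂ) : ℂ :=
  ((x₂ : ℂ) - Complex.I * x₁) - 2 * x₃ * ζ - ((x₂ : ℂ) + Complex.I * x₁) * ζ ^ 2

/-- The points `P_j = (ζ_j, η_j)`, `j = 1, …, 4`, are the four solutions, with multiplicity, of
the mini-twistor correspondence on the spectral curve: the `ζ_j` are the four (finite) roots of
the quartic Atiyah-Ward equation, whose leading coefficient is `K²/4 - (x₁ - i x₂)²`. -/
structure IsAtiyahWardSolution (k x₁ x₂ x₃ : ℝ) (ζ η : Fin 4 → ℂ) : Prop where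
  eta_eq : ∀ j, η j = twistorEta x₁ x₂ x₃ (ζ j)
  factor : ∀ w : ℂ, curvePoly k w (twistorEta x₁ x₂ x₃ w) =
    ((ellipticK k : ℂ) ^ 2 / 4 - ((x₁ : ℂ) - Complex.I * x₂) ^ 2) * ∏ j, (w - ζ j)

/-- `a` is an Abel image of the point `(ζ, η)` of the spectral curve: the integral of the
holomorphic differential `dζ / (4η)` along some path on the curve from `∞₁`, the point at
infinity where `η / ζ² → -i K / 2`, to `(ζ, η)`. The path `t ↦ (Z t, H t)`, `0 < t ≤ 1`, is
smooth and avoids the branch points, except perhaps at its end. -/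
def IsAbelImage (k : ℝ) (ζ η a : ℂ) : Prop :=
  ∃ Z H : ℝ → ℂ,
    ContinuousOn Z (Set.Ioc 0 1) ∧ ContinuousOn H (Set.Ioc 0 1) ∧
    (∀ t ∈ Set.Ioc (0 : ℝ) 1, curvePoly k (Z t) (H t) = 0) ∧
    ContDiffOn ℝ 1 Z (Set.Ioo 0 1) ∧ (∀ t ∈ Set.Ioo (0 : ℝ) 1, H t ≠ 0) ∧
    Filter.Tendsto (fun t => ‖Z t‖) (𝓝[>] 0) Filter.atTop ∧
    Filter.Tendsto (fun t => H t / Z t ^ 2) (𝓝[>] 0)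
      (𝓝 (-Complex.I * (ellipticK k : ℂ) / 2)) ∧
    Z 1 = ζ ∧ H 1 = η ∧
    IntervalIntegrable (fun t => deriv Z t / (4 * H t)) MeasureTheory.volume 0 1 ∧
    a = ∫ t in (0 : ℝ)..1, deriv Z t / (4 * H t)

/-- `β₁` as a function of the Abel image: `(θ₁'/θ₁ + θ₃'/θ₃) / 4`. -/
def beta1 (k : ℝ) (a : ℂ) : ℂ :=
  (deriv (theta1 k) a / theta1 k a + deriv (theta3 k) a / theta3 k a) / 4

/-- `μ = β₁ + iπN - i [(x₁ - i x₂) ζ - i x₃ - x₄]` for a point with coordinate `ζ` and Abel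
image `a`. -/
def mu (k x₁ x₂ x₃ x₄ : ℝ) (N : ℤ) (ζ a : ℂ) : ℂ :=
  beta1 k a + Complex.I * Real.pi * N -
    Complex.I * (((x₁ : ℂ) - Complex.I * x₂) * ζ - Complex.I * x₃ - x₄)

/-! ### Nahm data and the gauge transformation -/

/-- `f₃(z) = (π θ₂ θ₄ / 2) θ₄(z/2) / θ₂(z/2) = K k' / cn (K z)`. -/
def f3 (k : ℝ) (z : ℝ) : ℂ :=
  Real.pi * theta2 k 0 * theta4 k 0 / 2 * (theta4 k (z / 2) / theta2 k (z / 2))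

/-- `(1/2) ∫₀ᶻ f₃(s) ds`, for `z` in the interval `(-1, 1)`. -/
def halfInt (k : ℝ) (z : ℝ) : ℂ := (∫ s in (0 : ℝ)..z, f3 k s) / 2

/-- The gauge transformation `C(z) = [[F, G], [G, F]]` with `F = cosh (½ ∫₀ᶻ f₃)` and
`G = sinh (½ ∫₀ᶻ f₃)`. -/
def gaugeC (k : ℝ) (z : ℝ) : Matrix (Fin 2) (Fin 2) ℂ :=
  !![Complex.cosh (halfInt k z), Complex.sinh (halfInt k z);
     Complex.sinh (halfInt k z), Complex.cosh (halfInt k z)]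

/-- The orthogonal matrix `𝒪 = (1/√2) [[1, -1], [1, 1]]`. -/
def orthO : Matrix (Fin 2) (Fin 2) ℂ :=
  (1 / (Real.sqrt 2 : ℂ)) • !![1, -1; 1, 1]

/-! ### The solution columns -/

/-- The first entry `A` in `Λ̄ᵢ = (-i ζ_j, 1) ⊗ (A, B) + (1, 0) ⊗ (α, β)`; here and below `m` stands
for `μᵢ`, and `aj, ak, al` for the Abel images with the three indices different from `i`. -/
def colA (k : ℝ) (aj ak al m : ℂ) (z : ℂ) : ℂ :=
  theta2 k (z / 2) * theta2 k (aj + ak + al - z / 2) /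
    (theta3 k aj * theta3 k ak * theta3 k al) * Complex.exp (-z * m)

/-- The entry `B` of `Λ̄ᵢ`. -/
def colB (k : ℝ) (aj ak al m : ℂ) (z : ℂ) : ℂ :=
  theta2 k (z / 2) * theta4 k (aj + ak + al - z / 2) /
    (theta1 k aj * theta1 k ak * theta1 k al) * Complex.exp (-z * m)

/-- The entry `α` of `Λ̄ᵢ`. -/
def colAlpha (k : ℝ) (aj ak al m : ℂ) (z : ℂ) : ℂ :=
  theta2 k 0 * theta4 k 0 * theta3 k (aj + ak) * theta3 k (aj + al) *
      theta4 k (aj - z / 2) * theta4 k (ak + al - z / 2) /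
    (theta3 k aj *
      ((theta1 k aj * theta3 k aj) * (theta1 k ak * theta3 k ak) * (theta1 k al * theta3 k al))) *
    Complex.exp (-z * m)

/-- The entry `β` of `Λ̄ᵢ`. -/
def colBeta (k : ℝ) (aj ak al m : ℂ) (z : ℂ) : ℂ :=
  theta2 k 0 * theta4 k 0 * theta3 k (aj + ak) * theta3 k (aj + al) *
      theta2 k (aj - z / 2) * theta4 k (ak + al - z / 2) /
    (theta1 k aj *
      ((theta1 k aj * theta3 k aj) * (theta1 k ak * theta3 k ak) * (theta1 k al * theta3 k al))) *
    Complex.exp (-z * m)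

/-- The vector `Λ̄ᵢ(z)`, with `(i, j, k, l)` the cyclic permutation of the four labels that starts
at `i`. A vector of `ℂ² ⊗ ℂ² = ℂ⁴` is indexed by `Fin 2 × Fin 2`, in lexicographic order. -/
def lambdaBar (k x₁ x₂ x₃ x₄ : ℝ) (N : ℤ) (ζ a : Fin 4 → ℂ) (i : Fin 4) (z : ℂ) :
    Fin 2 × Fin 2 → ℂ := fun p =>
  let m := mu k x₁ x₂ x₃ x₄ N (ζ i) (a i)
  let aj := a (i + 1)
  let ak := a (i + 2)
  let al := a (i + 3)
  (![-Complex.I * ζ (i + 1), 1] : Fin 2 → ℂ) p.1 *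
      (![colA k aj ak al m z, colB k aj ak al m z] : Fin 2 → ℂ) p.2 +
    (![1, 0] : Fin 2 → ℂ) p.1 *
      (![colAlpha k aj ak al m z, colBeta k aj ak al m z] : Fin 2 → ℂ) p.2

/-- The solution column `v̄ᵢ(z) = (1₂ ⊗ 𝒪 C(z)⁻¹) θ₂(z/2)⁻² Λ̄ᵢ(z)`, for `z` in `(-1, 1)`. -/
def vBar (k x₁ x₂ x₃ x₄ : ℝ) (N : ℤ) (ζ a : Fin 4 → ℂ) (i : Fin 4) (z : ℝ) :
    Fin 2 × Fin 2 → ℂ :=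
  ((1 : Matrix (Fin 2) (Fin 2) ℂ) ⊗ₖ (orthO * (gaugeC k z)⁻¹)).mulVec
    ((1 / theta2 k (z / 2) ^ 2) • lambdaBar k x₁ x₂ x₃ x₄ N ζ a i z)

/-- `U = 1₂ ⊗ [[0, 1], [-1, 0]]`. -/
def matU : Matrix (Fin 2 × Fin 2) (Fin 2 × Fin 2) ℂ :=
  (1 : Matrix (Fin 2) (Fin 2) ℂ) ⊗ₖ !![0, 1; -1, 0]

/-- The convergent expansion `f(ξ) = ∑_{s ≥ 0} c_s ξ^(s - 5/2)` for all small `ξ > 0`. -/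
def HasPoleExpansion (f : ℝ → Fin 2 × Fin 2 → ℂ) (c : ℕ → Fin 2 × Fin 2 → ℂ) : Prop :=
  ∀ᶠ ξ in 𝓝[>] (0 : ℝ),
    HasSum (fun s : ℕ => ((ξ ^ ((s : ℝ) - 5 / 2) : ℝ) : ℂ) • c s) (f ξ)

end Monopole

end

/-!
Write `ξ` for the distance to an endpoint. The product formulas of the theta functions give Jacobi's
`θ₁'(0) = π θ₂(0) θ₃(0) θ₄(0)`, which says that `ξ f₃(1 - ξ)` is an even analytic germ with value
`1` at `ξ = 0`. Hence `exp (½ ∫₀^(1-ξ) f₃) = ξ^(-1/2) g(ξ)` with `g` analytic, even and without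
zeros, and together with the double pole of `θ₂⁻²` this gives `v̄ᵢ(1 - ξ) = ξ^(-5/2) Φ(ξ)` with `Φ`
analytic at `0`. At the other endpoint `∫₀ᶻ f₃` changes sign, and the quasi-periodicity of the theta
functions gives `Λ̄ᵢ(z) = e^(2μᵢ) (1₂ ⊗ diag(1, -1)) Λ̄ᵢ(z + 2)`; as `g` is even, the two combine to
`v̄ᵢ(-1 + ξ) = -e^(2μᵢ) ξ^(-5/2) U Φ(-ξ)`.
-/

noncomputable section

namespace Monopole

open Filter

/-! ### `q`-Pochhammer symbols -/

section QPochhammer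

/-- The finite `q`-Pochhammer symbol `(a; q)ₙ`. -/
def qPochhammer {R : Type*} [CommRing R] (a q : R) (n : ℕ) : R :=
  ∏ i ∈ Finset.range n, (1 - a * q ^ i)

lemma qPochhammer_zero {R : Type*} [CommRing R] (a q : R) : qPochhammer a q 0 = 1 :=
  Finset.prod_range_zero _

lemma qPochhammer_succ {R : Type*} [CommRing R] (a q : R) (n : ℕ) :
    qPochhammer a q (n + 1) = qPochhammer a q n * (1 - a * q ^ n) :=
  Finset.prod_range_succ _ n

/-- The infinite `q`-Pochhammer symbol `(a; q)_∞`, meaningful for `‖q‖ < 1`. -/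
def qPochhammerInf {𝕜 : Type*} [NormedField 𝕜] (a q : 𝕜) : 𝕜 := ∏' i : ℕ, (1 - a * q ^ i)

variable {𝕜 : Type*} [NormedField 𝕜] {q : 𝕜}

lemma norm_sq_lt_one (hq : ‖q‖ < 1) : ‖q ^ 2‖ < 1 := by
  rw [norm_pow]
  exact pow_lt_one₀ (norm_nonneg q) hq two_ne_zero

lemma one_sub_pow_succ_ne_zero (hq : ‖q‖ < 1) (n : ℕ) : 1 - q ^ (n + 1) ≠ 0 := fun h => by
  have h1 : ‖q ^ (n + 1)‖ < 1 := by
    rw [norm_pow]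
    exact pow_lt_one₀ (norm_nonneg q) hq n.succ_ne_zero
  rw [← sub_eq_zero.1 h, norm_one] at h1
  exact h1.false

lemma one_sub_mul_pow_ne_zero (hq : ‖q‖ < 1) {a : 𝕜} (ha : ‖a‖ < 1) (n : ℕ) :
    1 - a * q ^ n ≠ 0 := fun h => by
  have h1 : ‖a * q ^ n‖ < 1 := by
    rw [norm_mul, norm_pow]
    exact mul_lt_one_of_nonneg_of_lt_one_left (norm_nonneg a) ha
      (pow_le_one₀ (norm_nonneg q) hq.le)
  rw [← sub_eq_zero.1 h, norm_one] at h1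
  exact h1.false

lemma summable_norm_neg_mul_pow (hq : ‖q‖ < 1) (a : 𝕜) :
    Summable fun i : ℕ => ‖-(a * q ^ i)‖ := by
  simpa only [norm_neg, norm_mul, norm_pow] using
    (summable_geometric_of_lt_one (norm_nonneg q) hq).mul_left ‖a‖

variable [CompleteSpace 𝕜]

lemma multipliable_one_sub_mul_pow (hq : ‖q‖ < 1) (a : 𝕜) :
    Multipliable fun i : ℕ => 1 - a * q ^ i := by
  simpa only [sub_eq_add_neg] using
    multipliable_one_add_of_summable (summable_norm_neg_mul_pow hq a)

lemma tendsto_qPochhammer (hq : ‖q‖ < 1) (a : 𝕜) :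
    Tendsto (qPochhammer a q) atTop (𝓝 (qPochhammerInf a q)) :=
  (multipliable_one_sub_mul_pow hq a).hasProd.tendsto_prod_nat

lemma qPochhammerInf_eq_mul (hq : ‖q‖ < 1) (a : 𝕜) :
    qPochhammerInf a q = (1 - a) * qPochhammerInf (a * q) q := by
  have h := multipliable_one_sub_mul_pow hq (a * q)
  simp only [qPochhammerInf, mul_assoc, ← pow_succ'] at h ⊢
  simpa only [pow_zero, mul_one] using tprod_eq_zero_mul' (f := fun i => 1 - a * q ^ i) h

lemma qPochhammerInf_ne_zero (hq : ‖q‖ < 1) {a : 𝕜} (ha : ‖a‖ < 1) : qPochhammerInf a q ≠ 0 := by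
  simpa only [qPochhammerInf, sub_eq_add_neg] using
    tprod_one_add_ne_zero_of_summable
      (fun i => by simpa only [sub_eq_add_neg] using one_sub_mul_pow_ne_zero hq ha i)
      (summable_norm_neg_mul_pow hq a)

lemma continuous_qPochhammerInf (hq : ‖q‖ < 1) :
    Continuous fun a : 𝕜 => qPochhammerInf a q := by
  refine continuous_iff_continuousAt.2 fun a₀ => ?_
  simp only [ContinuousAt, qPochhammerInf, sub_eq_add_neg]
  refine tendsto_tprod_one_add_of_dominated_convergence
    (bound := fun i : ℕ => (‖a₀‖ + 1) * ‖q‖ ^ i)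
    ((summable_geometric_of_lt_one (norm_nonneg q) hq).mul_left _)
    (fun i => (continuous_id.mul continuous_const).neg.tendsto a₀) ?_
  filter_upwards [continuous_norm.continuousAt.eventually_lt continuousAt_const
    (lt_add_one ‖a₀‖)] with a ha i
  rw [norm_neg, norm_mul, norm_pow]
  exact mul_le_mul_of_nonneg_right ha.le (by positivity)

lemma qPochhammerInf_mul_neg (hq : ‖q‖ < 1) (a : 𝕜) :
    qPochhammerInf a q * qPochhammerInf (-a) q = qPochhammerInf (a ^ 2) (q ^ 2) := by
  rw [qPochhammerInf, qPochhammerInf,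
    ← (multipliable_one_sub_mul_pow hq a).tprod_mul (multipliable_one_sub_mul_pow hq (-a))]
  exact tprod_congr fun i => by ring

lemma qPochhammerInf_sq_mul (hq : ‖q‖ < 1) (a : 𝕜) :
    qPochhammerInf a (q ^ 2) * qPochhammerInf (a * q) (q ^ 2) = qPochhammerInf a q := by
  have even := multipliable_one_sub_mul_pow (norm_sq_lt_one hq) a
  have odd := multipliable_one_sub_mul_pow (norm_sq_lt_one hq) (a * q)
  simp only [qPochhammerInf, mul_assoc, ← pow_mul, ← pow_succ'] at even odd ⊢
  exact tprod_even_mul_odd (f := fun i => 1 - a * q ^ i) even odd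

/-- Euler: the partitions into distinct parts and those into odd parts are equinumerous. -/
lemma qPochhammerInf_euler (hq : ‖q‖ < 1) :
    qPochhammerInf (-q ^ 2) (q ^ 2) * qPochhammerInf (-q) (q ^ 2) * qPochhammerInf q (q ^ 2) =
      1 := by
  have hQ := norm_sq_lt_one hq
  refine mul_left_cancel₀ (qPochhammerInf_ne_zero hQ hQ) ?_
  have distinct := qPochhammerInf_mul_neg hq q
  have plus := qPochhammerInf_sq_mul hq (-q)
  have minus := qPochhammerInf_sq_mul hq q
  rw [neg_mul, ← sq] at plus
  rw [← sq] at minus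
  calc _ = (qPochhammerInf (-q) (q ^ 2) * qPochhammerInf (-q ^ 2) (q ^ 2)) *
        (qPochhammerInf q (q ^ 2) * qPochhammerInf (q ^ 2) (q ^ 2)) := by ring
    _ = qPochhammerInf (-q) q * qPochhammerInf q q := by rw [plus, minus]
    _ = qPochhammerInf (q ^ 2) (q ^ 2) * 1 := by rw [mul_comm, distinct, mul_one]

end QPochhammer

/-! ### `q`-binomial coefficients and the Jacobi triple product -/

section QBinomial

/-- The reciprocal `1 / (q; q)ₙ`, set to `0` for negative `n`. -/
def invQFactorial {K : Type*} [Field K] (q : K) : ℤ → K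
  | Int.ofNat n => (qPochhammer q q n)⁻¹
  | Int.negSucc _ => 0

/-- The Gaussian binomial coefficient `(q; q)ₙ / ((q; q)ⱼ (q; q)ₙ₋ⱼ)`. The lower index runs over
`ℤ`, and the coefficient vanishes unless `0 ≤ j ≤ n`. -/
def qBinomial {K : Type*} [Field K] (q : K) (n : ℕ) (j : ℤ) : K :=
  qPochhammer q q n * invQFactorial q j * invQFactorial q (n - j)

variable {K : Type*} [Field K] {q : K}

lemma invQFactorial_natCast (q : K) (n : ℕ) : invQFactorial q n = (qPochhammer q q n)⁻¹ := rfl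

lemma invQFactorial_zero (q : K) : invQFactorial q 0 = 1 := by
  rw [← Nat.cast_zero, invQFactorial_natCast, qPochhammer_zero, inv_one]

lemma invQFactorial_of_neg (q : K) {n : ℤ} (hn : n < 0) : invQFactorial q n = 0 := by
  obtain ⟨m, rfl⟩ := Int.eq_negSucc_of_lt_zero hn
  rfl

lemma invQFactorial_sub_one (hq : ∀ n : ℕ, 1 - q ^ (n + 1) ≠ 0) (n : ℤ) :
    invQFactorial q (n - 1) = (1 - q ^ n) * invQFactorial q n := by
  rcases lt_trichotomy n 0 with hn | rfl | hn
  · rw [invQFactorial_of_neg q hn, invQFactorial_of_neg q (by lia), mul_zero]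
  · rw [invQFactorial_of_neg q (by lia), zpow_zero, sub_self, zero_mul]
  · obtain ⟨m, rfl⟩ : ∃ m : ℕ, n = (m + 1 : ℕ) := ⟨(n - 1).toNat, by lia⟩
    rw [Nat.cast_succ, add_sub_cancel_right, ← Nat.cast_succ, invQFactorial_natCast,
      invQFactorial_natCast, qPochhammer_succ, zpow_natCast, ← pow_succ']
    field_simp [hq m]

lemma qBinomial_symm (q : K) (n : ℕ) (j : ℤ) : qBinomial q n (n - j) = qBinomial q n j := by
  rw [qBinomial, qBinomial, sub_sub_cancel, mul_right_comm]

lemma qBinomial_zero (q : K) (j : ℤ) : qBinomial q 0 j = if j = 0 then 1 else 0 := by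
  rcases lt_trichotomy j 0 with hj | rfl | hj
  · simp [qBinomial, invQFactorial_of_neg q hj, hj.ne]
  · simp [qBinomial, invQFactorial_zero, qPochhammer_zero]
  · simp [qBinomial, invQFactorial_of_neg q (neg_lt_zero.2 hj), hj.ne']

lemma qBinomial_succ (hq : ∀ n : ℕ, 1 - q ^ (n + 1) ≠ 0) (hq0 : q ≠ 0) (n : ℕ) (j : ℤ) :
    qBinomial q (n + 1) j = qBinomial q n (j - 1) + q ^ j * qBinomial q n j := by
  have lower := invQFactorial_sub_one hq j
  have upper := invQFactorial_sub_one hq (n + 1 - j)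
  have hpow : q * q ^ n = q ^ j * q ^ ((n : ℤ) + 1 - j) := by
    rw [← zpow_add₀ hq0, add_sub_cancel, zpow_add_one₀ hq0, zpow_natCast, mul_comm]
  rw [show (n : ℤ) + 1 - j - 1 = n - j by ring] at upper
  rw [qBinomial, qBinomial, qBinomial, qPochhammer_succ, lower, upper, hpow, Nat.cast_succ,
    show (n : ℤ) - (j - 1) = n + 1 - j by ring]
  ring

lemma qBinomial_succ' (hq : ∀ n : ℕ, 1 - q ^ (n + 1) ≠ 0) (hq0 : q ≠ 0) (n : ℕ) (j : ℤ) :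
    qBinomial q (n + 1) j = q ^ (n + 1 - j) * qBinomial q n (j - 1) + qBinomial q n j := by
  have h := qBinomial_succ hq hq0 n ((n + 1 : ℕ) - j)
  rw [qBinomial_symm, Nat.cast_succ, show (n : ℤ) + 1 - j - 1 = n - j by ring, qBinomial_symm,
    show (n : ℤ) + 1 - j = n - (j - 1) by ring, qBinomial_symm] at h
  rw [h, add_comm, show (n : ℤ) - (j - 1) = n + 1 - j by ring]

end QBinomial

section JacobiTripleProduct

lemma theta_term_shift {K : Type*} [Field K] {q : K} (hq0 : q ≠ 0) {w : K} (hw : w ≠ 0)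
    (M : ℕ) (m : ℤ) :
    q * w * (q ^ 2) ^ M * (q ^ ((m - 1) ^ 2) * w ^ (m - 1)) =
      (q ^ 2) ^ ((M : ℤ) + 1 - m) * (q ^ (m ^ 2) * w ^ m) := by
  have hpow : q * (q ^ 2) ^ M * q ^ ((m - 1) ^ 2) = (q ^ 2) ^ ((M : ℤ) + 1 - m) * q ^ (m ^ 2) := by
    rw [← zpow_natCast (q ^ 2), ← zpow_natCast q 2, ← zpow_mul, ← zpow_mul, ← zpow_one_add₀ hq0,
      ← zpow_add₀ hq0, ← zpow_add₀ hq0]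
    congr 1
    push_cast
    ring
  calc _ = q * (q ^ 2) ^ M * q ^ ((m - 1) ^ 2) * (w ^ (m - 1) * w) := by ring
    _ = _ := by rw [hpow, ← zpow_add_one₀ hw, sub_add_cancel, mul_assoc]

lemma hasSum_finite_triple_product {𝕜 : Type*} [NormedField 𝕜] {q : 𝕜} (hq0 : q ≠ 0)
    (hq : ∀ n : ℕ, 1 - (q ^ 2) ^ (n + 1) ≠ 0) {w : 𝕜} (hw : w ≠ 0) (M N : ℕ) :
    HasSum (fun m : ℤ => qBinomial (q ^ 2) (M + N) (N + m) * (q ^ (m ^ 2) * w ^ m))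
      (qPochhammer (-(q * w)) (q ^ 2) M * qPochhammer (-(q * w⁻¹)) (q ^ 2) N) := by
  have hQ0 : q ^ 2 ≠ 0 := pow_ne_zero 2 hq0
  induction M with
  | succ M ih =>
    have shifted := ((Equiv.subRight (1 : ℤ)).hasSum_iff.2 ih).mul_left (q * w * (q ^ 2) ^ M)
    convert ih.add shifted using 1
    · funext m
      have term := theta_term_shift hq0 hw M m
      have pascal := qBinomial_succ' hq hQ0 (M + N) (N + m)
      rw [show ((M + N : ℕ) : ℤ) + 1 - (N + m) = M + 1 - m by push_cast; ring,
        add_sub_assoc (N : ℤ)] at pascal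
      rw [add_right_comm, pascal, Function.comp_apply, Equiv.subRight_apply]
      linear_combination -qBinomial (q ^ 2) (M + N) (N + (m - 1)) * term
    · rw [qPochhammer_succ]
      ring
  | zero =>
    induction N with
    | zero =>
      simp only [add_zero, Nat.cast_zero, zero_add, qBinomial_zero, qPochhammer_zero, mul_one]
      convert hasSum_single (0 : ℤ) fun m hm => ?_ using 1
      · simp
      · simp [hm]
    | succ N ih =>
      have shifted := ((Equiv.addRight (1 : ℤ)).hasSum_iff.2 ih).mul_left (q * w⁻¹ * (q ^ 2) ^ N)
      convert ih.add shifted using 1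
      · funext m
        have term := theta_term_shift hq0 (inv_ne_zero hw) N (-m)
        rw [show (-m - 1) = -(m + 1) by ring, neg_sq, neg_sq, inv_zpow', inv_zpow', neg_neg,
          neg_neg, sub_neg_eq_add] at term
        have pascal := qBinomial_succ hq hQ0 (0 + N) (N + 1 + m)
        rw [show (N : ℤ) + 1 + m - 1 = N + m by ring, add_right_comm (N : ℤ), add_assoc (N : ℤ)]
          at pascal
        rw [← add_assoc, Nat.cast_succ, add_right_comm (N : ℤ), add_assoc (N : ℤ), pascal,
          Function.comp_apply, Equiv.coe_addRight]
        rw [add_right_comm, add_assoc] at term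
        linear_combination -qBinomial (q ^ 2) (0 + N) (N + (m + 1)) * term
      · rw [qPochhammer_succ]
        ring

lemma tendsto_invQFactorial {𝕜 : Type*} [NormedField 𝕜] [CompleteSpace 𝕜] {q : 𝕜} (hq : ‖q‖ < 1) :
    Tendsto (invQFactorial q) atTop (𝓝 (qPochhammerInf q q)⁻¹) := by
  have toNat : Tendsto Int.toNat atTop atTop :=
    tendsto_atTop_atTop.2 fun b => ⟨b, fun n hn => by lia⟩
  refine (((tendsto_qPochhammer hq q).inv₀ (qPochhammerInf_ne_zero hq hq)).comp toNat).congr' ?_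
  filter_upwards [eventually_ge_atTop 0] with n hn
  rw [Function.comp_apply, ← invQFactorial_natCast, Int.toNat_of_nonneg hn]

lemma tendsto_qBinomial_two_mul {𝕜 : Type*} [NormedField 𝕜] [CompleteSpace 𝕜] {q : 𝕜}
    (hq : ‖q‖ < 1) (m : ℤ) :
    Tendsto (fun N : ℕ => qBinomial q (N + N) (N + m)) atTop (𝓝 (qPochhammerInf q q)⁻¹) := by
  have top := (tendsto_qPochhammer hq q).comp (tendsto_id.atTop_add_atTop tendsto_id)
  have shift (m : ℤ) := (tendsto_invQFactorial hq).comp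
    (tendsto_atTop_add_const_right _ m tendsto_natCast_atTop_atTop)
  have h := (top.mul (shift m)).mul (shift (-m))
  rw [mul_inv_cancel₀ (qPochhammerInf_ne_zero hq hq), one_mul] at h
  refine h.congr fun N => ?_
  simp only [Function.comp_apply, id_eq, qBinomial]
  congr 2
  push_cast
  ring

lemma exists_norm_qBinomial_le {𝕜 : Type*} [NormedField 𝕜] [CompleteSpace 𝕜] {q : 𝕜}
    (hq : ‖q‖ < 1) : ∃ C, ∀ n j, ‖qBinomial q n j‖ ≤ C := by
  obtain ⟨A, hA⟩ := (Metric.isBounded_range_of_tendsto _ (tendsto_qPochhammer hq q)).exists_norm_le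
  obtain ⟨B, hB⟩ := (Metric.isBounded_range_of_tendsto _
    ((tendsto_invQFactorial hq).comp tendsto_natCast_atTop_atTop)).exists_norm_le
  have hB0 : 0 ≤ B := (norm_nonneg _).trans (hB _ ⟨0, rfl⟩)
  have bound (n : ℤ) : ‖invQFactorial q n‖ ≤ B := by
    obtain ⟨n, rfl⟩ | hn := (le_or_gt 0 n).imp_left Int.eq_ofNat_of_zero_le
    · exact hB _ ⟨n, rfl⟩
    · rwa [invQFactorial_of_neg q hn, norm_zero]
  refine ⟨A * B * B, fun n j => ?_⟩
  rw [qBinomial, norm_mul, norm_mul]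
  gcongr
  exacts [mul_nonneg ((norm_nonneg _).trans (hA _ ⟨0, rfl⟩)) hB0,
    (norm_nonneg _).trans (hA _ ⟨0, rfl⟩), hA _ ⟨n, rfl⟩, bound j, bound (n - j)]

lemma jacobiTheta₂_term_eq (n : ℤ) (z τ : ℂ) :
    jacobiTheta₂_term n z τ = Complex.exp (Real.pi * Complex.I * τ) ^ (n ^ 2) *
      Complex.exp (2 * Real.pi * Complex.I * z) ^ n := by
  rw [jacobiTheta₂_term, ← Complex.exp_int_mul, ← Complex.exp_int_mul, ← Complex.exp_add]
  congr 1
  push_cast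
  ring

/-- The Jacobi triple product identity, with `q = exp (iπτ)` and `w = exp (2πiz)`. -/
theorem jacobiTheta₂_eq_triple_product (z : ℂ) {τ : ℂ} (hτ : 0 < τ.im) {q w : ℂ}
    (hq : q = Complex.exp (Real.pi * Complex.I * τ))
    (hw : w = Complex.exp (2 * Real.pi * Complex.I * z)) :
    jacobiTheta₂ z τ = qPochhammerInf (q ^ 2) (q ^ 2) *
      (qPochhammerInf (-(q * w)) (q ^ 2) * qPochhammerInf (-(q * w⁻¹)) (q ^ 2)) := by
  have hq0 : q ≠ 0 := hq ▸ Complex.exp_ne_zero _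
  have hw0 : w ≠ 0 := hw ▸ Complex.exp_ne_zero _
  have hQ : ‖q ^ 2‖ < 1 := norm_sq_lt_one (by simpa [hq, Complex.norm_exp] using by positivity)
  obtain ⟨C, hC⟩ := exists_norm_qBinomial_le hQ
  have summable : Summable fun m : ℤ => ‖q ^ (m ^ 2) * w ^ m‖ := by
    simpa only [jacobiTheta₂_term_eq, ← hq, ← hw] using
      ((summable_jacobiTheta₂_term_iff z τ).2 hτ).norm
  have series := tendsto_tsum_of_dominated_convergence (summable.mul_left C)
    (fun m => (tendsto_qBinomial_two_mul hQ m).mul_const _)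
    (.of_forall fun N m => by
      rw [norm_mul]
      exact mul_le_mul_of_nonneg_right (hC (N + N) (N + m)) (norm_nonneg _))
  have product := (tendsto_qPochhammer hQ (-(q * w))).mul (tendsto_qPochhammer hQ (-(q * w⁻¹)))
  simp only [fun N : ℕ => (hasSum_finite_triple_product hq0 (one_sub_pow_succ_ne_zero hQ) hw0
    N N).tsum_eq, tsum_mul_left] at series
  rw [← tendsto_nhds_unique series product,
    mul_inv_cancel_left₀ (qPochhammerInf_ne_zero hQ hQ), jacobiTheta₂]
  exact tsum_congr fun n => by rw [jacobiTheta₂_term_eq, hq, hw]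

end JacobiTripleProduct

/-! ### Theta functions -/

section Theta

lemma ellipticK_pos {k : ℝ} (hk : k ^ 2 < 1) : 0 < ellipticK k := by
  have radicand_pos (u : ℝ) : 0 < 1 - k ^ 2 * Real.sin u ^ 2 := by
    nlinarith [Real.sin_sq_le_one u, sq_nonneg k]
  have continuous : Continuous fun u => 1 / Real.sqrt (1 - k ^ 2 * Real.sin u ^ 2) :=
    continuous_const.div (by fun_prop) fun u => (Real.sqrt_pos.2 (radicand_pos u)).ne'
  exact intervalIntegral.intervalIntegral_pos_of_pos (continuous.intervalIntegrable _ _)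
    (fun u => one_div_pos.2 (Real.sqrt_pos.2 (radicand_pos u))) Real.pi_div_two_pos

lemma tau_im_pos {k : ℝ} (hk0 : 0 < k) (hk1 : k < 1) : 0 < (tau k).im := by
  have hK : 0 < ellipticK k := ellipticK_pos (by nlinarith)
  have hK' : 0 < ellipticK (compl k) :=
    ellipticK_pos (by rw [compl, Real.sq_sqrt] <;> nlinarith)
  have htau : tau k = ((ellipticK (compl k) / ellipticK k : ℝ) : ℂ) * Complex.I := by
    rw [tau, Complex.ofReal_div]
    ring
  rw [htau, Complex.im_ofReal_mul, Complex.I_im, mul_one]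
  exact div_pos hK' hK

variable (k : ℝ)

lemma theta3_neg (z : ℂ) : theta3 k (-z) = theta3 k z := jacobiTheta₂_neg_left _ _

lemma theta4_add_one (z : ℂ) : theta4 k (z + 1) = theta4 k z := by
  rw [theta4, theta4, add_right_comm, jacobiTheta₂_add_left]

lemma theta4_neg (z : ℂ) : theta4 k (-z) = theta4 k z := by
  rw [theta4, theta4, ← jacobiTheta₂_neg_left, ← jacobiTheta₂_add_left]
  ring_nf

lemma theta4_half_sub (z : ℂ) : theta4 k (1 / 2 - z) = theta3 k z := by
  rw [← theta3_neg, theta4, theta3, ← jacobiTheta₂_add_left (-z)]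
  ring_nf

lemma theta2_add_one (z : ℂ) : theta2 k (z + 1) = -theta2 k z := by
  rw [theta2, theta2, add_right_comm, jacobiTheta₂_add_left, ← add_assoc, mul_add, mul_one,
    Complex.exp_add_pi_mul_I, neg_mul]

lemma theta2_neg (z : ℂ) : theta2 k (-z) = theta2 k z := by
  rw [theta2, theta2, show z + tau k / 2 = (z - tau k / 2) + tau k by ring, jacobiTheta₂_add_left',
    ← jacobiTheta₂_neg_left (-z + tau k / 2), ← mul_assoc, ← Complex.exp_add]
  ring_nf

lemma theta1_eq_theta2 (z : ℂ) : theta1 k z = theta2 k (z - 1 / 2) := by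
  rw [theta1, theta2, show z + (1 + tau k) / 2 = z - 1 / 2 + tau k / 2 + 1 by ring,
    jacobiTheta₂_add_left, show Real.pi * Complex.I * (tau k / 4 + (z - 1 / 2)) =
      -(Real.pi / 2 * Complex.I) + Real.pi * Complex.I * (tau k / 4 + z) by ring, Complex.exp_add,
    Complex.exp_neg, Complex.exp_pi_div_two_mul_I, Complex.inv_I]

lemma theta2_half_sub (z : ℂ) : theta2 k (1 / 2 - z) = theta1 k z := by
  rw [theta1_eq_theta2, ← theta2_neg, neg_sub]

lemma theta1_neg (z : ℂ) : theta1 k (-z) = -theta1 k z := by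
  rw [theta1_eq_theta2, theta1_eq_theta2, ← theta2_add_one, ← theta2_neg]
  ring_nf

lemma theta1_zero : theta1 k 0 = 0 :=
  self_eq_neg.1 (by simpa using theta1_neg k 0)

variable {k}

lemma differentiable_theta3 (hτ : 0 < (tau k).im) : Differentiable ℂ (theta3 k) :=
  fun z => differentiableAt_jacobiTheta₂_fst z hτ

lemma differentiable_theta4 (hτ : 0 < (tau k).im) : Differentiable ℂ (theta4 k) :=
  (differentiable_theta3 hτ).comp (differentiable_id.add_const _)

lemma differentiable_theta2 (hτ : 0 < (tau k).im) : Differentiable ℂ (theta2 k) :=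
  Differentiable.mul (by fun_prop)
    ((differentiable_theta3 hτ).comp (differentiable_id.add_const _))

lemma differentiable_theta1 (hτ : 0 < (tau k).im) : Differentiable ℂ (theta1 k) :=
  Differentiable.mul (by fun_prop)
    ((differentiable_theta3 hτ).comp (differentiable_id.add_const _))

/-- The nome `q = exp (iπτ)`. -/
def nome (k : ℝ) : ℂ := Complex.exp (Real.pi * Complex.I * tau k)

lemma norm_nome_lt_one (hτ : 0 < (tau k).im) : ‖nome k‖ < 1 := by
  simpa [nome, Complex.norm_exp] using mul_pos Real.pi_pos hτ

lemma theta3_zero_eq_product (hτ : 0 < (tau k).im) :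
    theta3 k 0 = qPochhammerInf (nome k ^ 2) (nome k ^ 2) *
      qPochhammerInf (-nome k) (nome k ^ 2) ^ 2 := by
  rw [theta3, jacobiTheta₂_eq_triple_product 0 hτ (q := nome k) (w := 1) rfl (by simp), inv_one,
    mul_one, ← sq]

lemma theta4_zero_eq_product (hτ : 0 < (tau k).im) :
    theta4 k 0 = qPochhammerInf (nome k ^ 2) (nome k ^ 2) *
      qPochhammerInf (nome k) (nome k ^ 2) ^ 2 := by
  have hw : -1 = Complex.exp (2 * Real.pi * Complex.I * (0 + 1 / 2)) := by
    rw [← Complex.exp_pi_mul_I]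
    ring_nf
  rw [theta4, jacobiTheta₂_eq_triple_product _ hτ (q := nome k) rfl hw, inv_neg_one,
    mul_neg_one, neg_neg, ← sq]

lemma theta2_eq_product (hτ : 0 < (tau k).im) (z : ℂ) :
    theta2 k z = 2 * Complex.cos (Real.pi * z) * (Complex.exp (Real.pi * Complex.I * (tau k / 4)) *
      (qPochhammerInf (nome k ^ 2) (nome k ^ 2) *
        (qPochhammerInf (-(nome k ^ 2 * Complex.exp (2 * Real.pi * Complex.I * z))) (nome k ^ 2) *
          qPochhammerInf (-(nome k ^ 2 * Complex.exp (-(2 * Real.pi * Complex.I * z))))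
            (nome k ^ 2)))) := by
  set w := Complex.exp (2 * Real.pi * Complex.I * z) with hw
  have hqw : nome k * w = Complex.exp (2 * Real.pi * Complex.I * (z + tau k / 2)) := by
    rw [nome, hw, ← Complex.exp_add]
    ring_nf
  have two_cos : 2 * Complex.cos (Real.pi * z) =
      Complex.exp (Real.pi * Complex.I * z) * (1 + w⁻¹) := by
    rw [Complex.two_cos, hw, ← Complex.exp_neg, mul_add, mul_one, ← Complex.exp_add]
    ring_nf
  rw [theta2, jacobiTheta₂_eq_triple_product _ hτ (q := nome k) rfl hqw, mul_inv,
    mul_inv_cancel_left₀ (show nome k ≠ 0 from Complex.exp_ne_zero _),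
    qPochhammerInf_eq_mul (norm_sq_lt_one (norm_nome_lt_one hτ)) (-w⁻¹), two_cos, mul_add,
    Complex.exp_add, Complex.exp_neg, ← hw]
  ring_nf

lemma theta1_eq_product (hτ : 0 < (tau k).im) (z : ℂ) :
    theta1 k z = 2 * Complex.sin (Real.pi * z) * (Complex.exp (Real.pi * Complex.I * (tau k / 4)) *
      (qPochhammerInf (nome k ^ 2) (nome k ^ 2) *
        (qPochhammerInf (nome k ^ 2 * Complex.exp (2 * Real.pi * Complex.I * z)) (nome k ^ 2) *
          qPochhammerInf (nome k ^ 2 * Complex.exp (-(2 * Real.pi * Complex.I * z)))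
            (nome k ^ 2)))) := by
  have hcos : Complex.cos (Real.pi * (1 / 2 - z)) = Complex.sin (Real.pi * z) := by
    rw [← Complex.cos_pi_div_two_sub]
    ring_nf
  have hexp : Complex.exp (2 * Real.pi * Complex.I * (1 / 2 - z)) =
      -Complex.exp (-(2 * Real.pi * Complex.I * z)) := by
    rw [← Complex.exp_add_pi_mul_I]
    ring_nf
  have hexp' : Complex.exp (-(2 * Real.pi * Complex.I * (1 / 2 - z))) =
      -Complex.exp (2 * Real.pi * Complex.I * z) := by
    rw [← Complex.exp_sub_pi_mul_I]
    ring_nf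
  rw [← theta2_half_sub, theta2_eq_product hτ, hcos, hexp, hexp', mul_neg, neg_neg, mul_neg,
    neg_neg, mul_comm (qPochhammerInf (nome k ^ 2 * Complex.exp (-_)) _)]

lemma theta2_ofReal_ne_zero (hτ : 0 < (tau k).im) {x : ℝ} (hx : |x| < 1 / 2) :
    theta2 k x ≠ 0 := by
  have hQ := norm_sq_lt_one (norm_nome_lt_one hτ)
  have norm_exp : ‖Complex.exp (2 * Real.pi * Complex.I * x)‖ = 1 := by
    rw [show 2 * Real.pi * Complex.I * (x : ℂ) = ((2 * Real.pi * x : ℝ) : ℂ) * Complex.I by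
      push_cast; ring, Complex.norm_exp_ofReal_mul_I]
  have cos_ne_zero : Complex.cos (Real.pi * x) ≠ 0 := by
    obtain ⟨hlo, hhi⟩ := abs_lt.1 hx
    exact_mod_cast (Real.cos_pos_of_mem_Ioo
      ⟨by nlinarith [Real.pi_pos], by nlinarith [Real.pi_pos]⟩).ne'
  rw [theta2_eq_product hτ]
  refine mul_ne_zero (mul_ne_zero two_ne_zero cos_ne_zero) <| mul_ne_zero (Complex.exp_ne_zero _) <|
    mul_ne_zero (qPochhammerInf_ne_zero hQ hQ) <|
      mul_ne_zero (qPochhammerInf_ne_zero hQ ?_) (qPochhammerInf_ne_zero hQ ?_)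
  · rwa [norm_neg, norm_mul, norm_exp, mul_one]
  · rwa [norm_neg, norm_mul, Complex.exp_neg, norm_inv, norm_exp, inv_one, mul_one]

lemma hasDerivAt_mul_of_eq_zero {𝕜 : Type*} [NontriviallyNormedField 𝕜]
    {f g : 𝕜 → 𝕜} {f' x : 𝕜}
    (hf : HasDerivAt f f' x) (hx : f x = 0) (hg : ContinuousAt g x) :
    HasDerivAt (fun z => f z * g z) (f' * g x) x := by
  rw [hasDerivAt_iff_tendsto_slope] at hf ⊢
  refine (hf.mul (hg.tendsto.mono_left nhdsWithin_le_nhds)).congr fun z => ?_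
  rw [slope_def_field, slope_def_field, hx, zero_mul, sub_zero, sub_zero, div_mul_eq_mul_div]

lemma hasDerivAt_theta1_zero (hτ : 0 < (tau k).im) :
    HasDerivAt (theta1 k) (2 * Real.pi * (Complex.exp (Real.pi * Complex.I * (tau k / 4)) *
      qPochhammerInf (nome k ^ 2) (nome k ^ 2) ^ 3)) 0 := by
  have hsin : HasDerivAt (fun z : ℂ => 2 * Complex.sin (Real.pi * z)) (2 * Real.pi) 0 := by
    simpa using (((hasDerivAt_id (0 : ℂ)).const_mul (Real.pi : ℂ)).csin).const_mul 2
  have hcont := continuous_qPochhammerInf (norm_sq_lt_one (norm_nome_lt_one hτ))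
  rw [funext (theta1_eq_product hτ)]
  refine (hasDerivAt_mul_of_eq_zero hsin (by simp)
    (Continuous.continuousAt (by fun_prop))).congr_deriv ?_
  simp only [mul_zero, neg_zero, Complex.exp_zero, mul_one]
  ring

lemma deriv_theta1_zero_ne_zero (hτ : 0 < (tau k).im) : deriv (theta1 k) 0 ≠ 0 := by
  have hQ := norm_sq_lt_one (norm_nome_lt_one hτ)
  rw [(hasDerivAt_theta1_zero hτ).deriv]
  exact mul_ne_zero (mul_ne_zero two_ne_zero (Complex.ofReal_ne_zero.2 Real.pi_ne_zero))
    (mul_ne_zero (Complex.exp_ne_zero _) (pow_ne_zero 3 (qPochhammerInf_ne_zero hQ hQ)))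

theorem deriv_theta1_zero (hτ : 0 < (tau k).im) :
    deriv (theta1 k) 0 = Real.pi * theta2 k 0 * theta3 k 0 * theta4 k 0 := by
  have euler := qPochhammerInf_euler (norm_nome_lt_one hτ)
  rw [(hasDerivAt_theta1_zero hτ).deriv, theta3_zero_eq_product hτ, theta4_zero_eq_product hτ,
    theta2_eq_product hτ]
  simp only [mul_zero, neg_zero, Complex.exp_zero, mul_one, Complex.cos_zero]
  set P := qPochhammerInf (nome k ^ 2) (nome k ^ 2)
  set κ := Complex.exp (Real.pi * Complex.I * (tau k / 4))
  calc _ = 2 * Real.pi * κ * P ^ 3 * 1 ^ 2 := by ring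
    _ = _ := by
      rw [← euler]
      ring

end Theta

/-! ### Expansions in half-integral powers -/

section Expansions

lemma exists_hasFPowerSeriesAt_of_summable {𝕜 E : Type*} [NontriviallyNormedField 𝕜]
    [NormedAddCommGroup E] [NormedSpace 𝕜 E] [CompleteSpace E] {c : ℕ → E} {r : 𝕜} (hr : r ≠ 0)
    (hc : Summable fun s : ℕ => r ^ s • c s) :
    ∃ p : FormalMultilinearSeries 𝕜 𝕜 E, p.coeff = c ∧
      HasFPowerSeriesAt (fun z => ∑' s : ℕ, z ^ s • c s) p 0 := by
  let p : FormalMultilinearSeries 𝕜 𝕜 E := fun s =>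
    ContinuousMultilinearMap.mkPiRing 𝕜 (Fin s) (c s)
  have coeff_eq : p.coeff = c := by
    funext s
    simp [p, FormalMultilinearSeries.coeff]
  have terms_tendsto : Tendsto (fun s => ‖p s‖ * ‖r‖₊ ^ s) atTop (𝓝 0) := by
    simpa only [p, ContinuousMultilinearMap.norm_mkPiRing, norm_smul, norm_pow, norm_zero,
      coe_nnnorm, mul_comm] using hc.tendsto_atTop_zero.norm
  have radius_pos : 0 < p.radius :=
    (ENNReal.coe_pos.2 (nnnorm_pos.2 hr)).trans_le (p.le_radius_of_tendsto terms_tendsto)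
  refine ⟨p, coeff_eq, ?_⟩
  convert (p.hasFPowerSeriesOnBall radius_pos).hasFPowerSeriesAt using 1
  funext z
  exact tsum_congr fun s => by rw [p.apply_eq_pow_smul_coeff, coeff_eq]

lemma coeff_eq_of_frequently_hasSum {𝕜 E : Type*} [NontriviallyNormedField 𝕜]
    [NormedAddCommGroup E] [NormedSpace 𝕜 E] [CompleteSpace E] {f : 𝕜 → E}
    {p : FormalMultilinearSeries 𝕜 𝕜 E} (hp : HasFPowerSeriesAt f p 0) {c : ℕ → E}
    (hc : ∃ᶠ z in 𝓝[≠] (0 : 𝕜), HasSum (fun s : ℕ => z ^ s • c s) (f z)) : p.coeff = c := by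
  obtain ⟨r, hr, hr0⟩ := (hc.and_eventually self_mem_nhdsWithin).exists
  obtain ⟨p', rfl, hp'⟩ := exists_hasFPowerSeriesAt_of_summable hr0 hr.summable
  have agree : f =ᶠ[𝓝 0] fun z => ∑' s : ℕ, z ^ s • p'.coeff s :=
    (hp.analyticAt.frequently_eq_iff_eventually_eq hp'.analyticAt).1
      (hc.mono fun z hz => hz.tsum_eq.symm)
  rw [hp.eq_formalMultilinearSeries_of_eventually hp' agree]

lemma tendsto_ofReal_nhdsGT_zero : Tendsto (fun ξ : ℝ => (ξ : ℂ)) (𝓝[>] 0) (𝓝[≠] 0) :=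
  tendsto_nhdsWithin_iff.2
    ⟨(Complex.continuous_ofReal.tendsto' 0 0 Complex.ofReal_zero).mono_left nhdsWithin_le_nhds,
      eventually_mem_nhdsWithin.mono fun _ hξ => Complex.ofReal_ne_zero.2 (ne_of_gt hξ)⟩

variable {f : ℝ → Fin 2 × Fin 2 → ℂ} {c : ℕ → Fin 2 × Fin 2 → ℂ}

lemma hasPoleExpansion_iff {Φ : ℝ → Fin 2 × Fin 2 → ℂ}
    (hf : ∀ᶠ ξ : ℝ in 𝓝[>] 0, f ξ = ((ξ ^ (-(5 / 2) : ℝ) : ℝ) : ℂ) • Φ ξ) :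
    HasPoleExpansion f c ↔ ∀ᶠ ξ : ℝ in 𝓝[>] 0, HasSum (fun s : ℕ => (ξ : ℂ) ^ s • c s) (Φ ξ) := by
  refine eventually_congr ?_
  filter_upwards [hf, self_mem_nhdsWithin] with ξ hfξ (hξ : 0 < ξ)
  have factor (s : ℕ) : ((ξ ^ ((s : ℝ) - 5 / 2) : ℝ) : ℂ) =
      ((ξ ^ (-(5 / 2) : ℝ) : ℝ) : ℂ) * (ξ : ℂ) ^ s := by
    rw [sub_eq_neg_add, Real.rpow_add hξ, Real.rpow_natCast, Complex.ofReal_mul,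
      Complex.ofReal_pow]
  have hne : ((ξ ^ (-(5 / 2) : ℝ) : ℝ) : ℂ) ≠ 0 :=
    Complex.ofReal_ne_zero.2 (Real.rpow_pos_of_pos hξ _).ne'
  simp only [factor, mul_smul, hfξ]
  refine ⟨fun hs => ?_, fun hs => hs.const_smul _⟩
  simpa only [inv_smul_smul₀ hne] using hs.const_smul ((ξ ^ (-(5 / 2) : ℝ) : ℝ) : ℂ)⁻¹

variable {Φ : ℂ → Fin 2 × Fin 2 → ℂ} {p : FormalMultilinearSeries ℂ ℂ (Fin 2 × Fin 2 → ℂ)}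

lemma hasPoleExpansion_iff_eq_coeff (hp : HasFPowerSeriesAt Φ p 0)
    (hf : ∀ᶠ ξ : ℝ in 𝓝[>] 0, f ξ = ((ξ ^ (-(5 / 2) : ℝ) : ℝ) : ℂ) • Φ ξ) :
    HasPoleExpansion f c ↔ c = p.coeff := by
  rw [hasPoleExpansion_iff (Φ := fun ξ => Φ ξ) hf]
  refine ⟨fun hc => (coeff_eq_of_frequently_hasSum hp
    (tendsto_ofReal_nhdsGT_zero.frequently hc.frequently)).symm, ?_⟩
  rintro rfl
  have hasSum := hasFPowerSeriesAt_iff.1 hp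
  simp only [zero_add] at hasSum
  exact (tendsto_ofReal_nhdsGT_zero.mono_right nhdsWithin_le_nhds).eventually hasSum

lemma HasPoleExpansion.comp_neg_smul_mulVec (hc : HasPoleExpansion f c) (hΦ : AnalyticAt ℂ Φ 0)
    (hf : ∀ᶠ ξ : ℝ in 𝓝[>] 0, f ξ = ((ξ ^ (-(5 / 2) : ℝ) : ℝ) : ℂ) • Φ ξ) {e : ℂ}
    {M : Matrix (Fin 2 × Fin 2) (Fin 2 × Fin 2) ℂ} {g : ℝ → Fin 2 × Fin 2 → ℂ}
    (hg : ∀ᶠ ξ : ℝ in 𝓝[>] 0,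
      g ξ = ((ξ ^ (-(5 / 2) : ℝ) : ℝ) : ℂ) • (-e) • M.mulVec (Φ (-ξ))) :
    HasPoleExpansion g fun s => -((-1 : ℂ) ^ s * e) • M.mulVec (c s) := by
  obtain ⟨p, hp⟩ := hΦ
  obtain rfl := (hasPoleExpansion_iff_eq_coeff hp hf).1 hc
  have hasSum := hasFPowerSeriesAt_iff.1 hp
  simp only [zero_add] at hasSum
  have neg_tendsto : Tendsto (fun ξ : ℝ => -(ξ : ℂ)) (𝓝[>] 0) (𝓝 0) := by
    simpa using (tendsto_ofReal_nhdsGT_zero.mono_right nhdsWithin_le_nhds).neg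
  rw [hasPoleExpansion_iff (Φ := fun ξ => (-e) • M.mulVec (Φ (-ξ))) hg]
  filter_upwards [neg_tendsto.eventually hasSum] with ξ hξ
  have image_hasSum := (hξ.mapL (Matrix.mulVecLin M).toContinuousLinearMap).const_smul (-e)
  refine image_hasSum.congr_fun fun s => ?_
  simp only [map_smul, LinearMap.coe_toContinuousLinearMap', Matrix.mulVecLin_apply, smul_smul]
  rw [neg_pow]
  ring_nf

end Expansions

/-! ### The singularity of the Nahm data -/

section NahmData

lemma exists_even_hasDerivAt {φ : ℂ → ℂ} (hφ : AnalyticAt ℂ φ 0) (hφ_even : Function.Even φ) :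
    ∃ Ψ : ℂ → ℂ, AnalyticAt ℂ Ψ 0 ∧ Function.Even Ψ ∧
      ∀ᶠ z in 𝓝[≠] 0, HasDerivAt Ψ ((φ z - φ 0) / z) z := by
  obtain ⟨p, hp⟩ := hφ
  obtain ⟨r, hr, analytic⟩ := Metric.eventually_nhds_iff_ball.1
    hp.has_fpower_series_dslope_fslope.analyticAt.eventually_analyticAt
  have hball : Metric.ball (0 : ℂ) r ∈ 𝓝 0 := Metric.ball_mem_nhds 0 hr
  obtain ⟨Ψ, hΨ⟩ : Complex.IsExactOn (dslope φ 0) (Metric.ball 0 r) :=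
    DifferentiableOn.isExactOn_ball fun z hz =>
      (analytic z hz).differentiableAt.differentiableWithinAt
  have hΨ_analytic : AnalyticAt ℂ Ψ 0 :=
    DifferentiableOn.analyticAt
      (fun z hz => (hΨ z hz).differentiableAt.differentiableWithinAt) hball
  refine ⟨fun z => (Ψ z + Ψ (-z)) / 2, ?_, fun z => by simp only [neg_neg, add_comm], ?_⟩
  · exact (hΨ_analytic.add (hΨ_analytic.comp_of_eq analyticAt_id.neg neg_zero)).div_const
  · filter_upwards [nhdsWithin_le_nhds hball, self_mem_nhdsWithin] with z hz (hz0 : z ≠ 0)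
    have neg_mem : -z ∈ Metric.ball (0 : ℂ) r := by simpa using hz
    have neg_deriv := (hΨ (-z) neg_mem).scomp z (hasDerivAt_neg z)
    refine (((hΨ z hz).add neg_deriv).div_const 2).congr_deriv ?_
    rw [dslope_of_ne _ hz0, dslope_of_ne _ (neg_ne_zero.2 hz0), slope_def_field, slope_def_field,
      hφ_even, smul_eq_mul, sub_zero, sub_zero]
    field_simp
    ring

/-- A simple pole of `h'` with odd Laurent series integrates to a logarithm plus an even germ. -/
lemma exists_exp_eq_cpow_mul {φ : ℂ → ℂ} (hφ : AnalyticAt ℂ φ 0) (hφ_even : Function.Even φ)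
    {h : ℝ → ℂ} (hh : ∀ᶠ ξ : ℝ in 𝓝[>] 0, HasDerivAt h (φ ξ / ξ) ξ) :
    ∃ g : ℂ → ℂ, AnalyticAt ℂ g 0 ∧ (∀ z, g z ≠ 0) ∧ Function.Even g ∧
      ∀ᶠ ξ : ℝ in 𝓝[>] 0, Complex.exp (h ξ) = (ξ : ℂ) ^ φ 0 * g ξ := by
  obtain ⟨Ψ, hΨ, hΨ_even, hΨ_deriv⟩ := exists_even_hasDerivAt hφ hφ_even
  obtain ⟨ε, hε, small⟩ := mem_nhdsGT_iff_exists_Ioo_subset.1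
    (hh.and (tendsto_ofReal_nhdsGT_zero.eventually hΨ_deriv))
  have deriv_zero : ∀ ξ ∈ Set.Ioo (0 : ℝ) ε,
      HasDerivAt (fun ξ : ℝ => h ξ - φ 0 * (Real.log ξ : ℂ) - Ψ ξ) 0 ξ := by
    intro ξ hξ
    obtain ⟨h_deriv, Ψ_deriv⟩ := small hξ
    have log_deriv := (Real.hasDerivAt_log hξ.1.ne').ofReal_comp.const_mul (φ 0)
    refine ((h_deriv.sub log_deriv).sub Ψ_deriv.comp_ofReal).congr_deriv ?_
    push_cast
    ring
  obtain ⟨C, hC⟩ := isOpen_Ioo.exists_is_const_of_deriv_eq_zero isPreconnected_Ioo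
    (fun ξ hξ => (deriv_zero ξ hξ).differentiableAt.differentiableWithinAt)
    (fun ξ hξ => (deriv_zero ξ hξ).deriv)
  refine ⟨fun z => Complex.exp (C + Ψ z), (analyticAt_const.add hΨ).cexp,
    fun _ => Complex.exp_ne_zero _, fun z => by simp only [hΨ_even z], ?_⟩
  filter_upwards [Ioo_mem_nhdsGT hε] with ξ hξ
  rw [Complex.cpow_def_of_ne_zero (Complex.ofReal_ne_zero.2 hξ.1.ne'), ← Complex.exp_add,
    ← hC ξ hξ, Complex.ofReal_log hξ.1.le]
  ring_nf

variable {k : ℝ}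

lemma f3_neg (z : ℝ) : f3 k (-z) = f3 k z := by
  simp only [f3, Complex.ofReal_neg, neg_div, theta4_neg, theta2_neg]

lemma halfInt_neg (z : ℝ) : halfInt k (-z) = -halfInt k z := by
  have h := intervalIntegral.integral_comp_neg (f3 k) (a := 0) (b := z)
  simp only [f3_neg, neg_zero] at h
  rw [halfInt, halfInt, intervalIntegral.integral_symm, ← h, neg_div]

lemma continuousOn_f3 (hτ : 0 < (tau k).im) : ContinuousOn (f3 k) (Set.Ioo (-1) 1) := by
  have h4 := (differentiable_theta4 hτ).continuous
  have h2 := (differentiable_theta2 hτ).continuous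
  refine continuousOn_const.mul (ContinuousOn.div ?_ ?_ fun z hz => ?_)
  · fun_prop
  · fun_prop
  · have half_lt : |z / 2| < 1 / 2 := abs_lt.2 ⟨by linarith [hz.1], by linarith [hz.2]⟩
    simpa using theta2_ofReal_ne_zero hτ half_lt

lemma hasDerivAt_halfInt (hτ : 0 < (tau k).im) {z : ℝ} (hz : z ∈ Set.Ioo (-1 : ℝ) 1) :
    HasDerivAt (halfInt k) (f3 k z / 2) z := by
  have hcont := continuousOn_f3 hτ
  have hsub : Set.uIcc 0 z ⊆ Set.Ioo (-1) 1 :=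
    Set.ordConnected_Ioo.uIcc_subset (by norm_num) hz
  exact (intervalIntegral.integral_hasDerivAt_right (hcont.mono hsub).intervalIntegrable
    (hcont.stronglyMeasurableAtFilter isOpen_Ioo z hz)
    (hcont.continuousAt (isOpen_Ioo.mem_nhds hz))).div_const 2

/-- The function `θ₁(ξ/2) / ξ`, extended to `ξ = 0`. -/
def thetaSlope (k : ℝ) : ℂ → ℂ := dslope (fun ξ => theta1 k (ξ / 2)) 0

lemma mul_thetaSlope (ξ : ℂ) : ξ * thetaSlope k ξ = theta1 k (ξ / 2) := by
  simpa [theta1_zero, thetaSlope] using sub_smul_dslope (fun ξ => theta1 k (ξ / 2)) 0 ξ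

lemma theta2_one_sub_div_two (ξ : ℂ) : theta2 k ((1 - ξ) / 2) = ξ * thetaSlope k ξ := by
  rw [mul_thetaSlope, ← theta2_half_sub, sub_div]

lemma even_thetaSlope : Function.Even (thetaSlope k) := fun ξ => by
  rcases eq_or_ne ξ 0 with rfl | hξ
  · rw [neg_zero]
  · apply mul_left_cancel₀ hξ
    rw [mul_thetaSlope, ← neg_inj, ← neg_mul, mul_thetaSlope, neg_div, theta1_neg]

lemma differentiable_thetaSlope (hτ : 0 < (tau k).im) : Differentiable ℂ (thetaSlope k) := by
  have h := (differentiable_theta1 hτ).comp (differentiable_id.div_const 2)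
  exact differentiableOn_univ.1 ((Complex.differentiableOn_dslope univ_mem).2 h.differentiableOn)

lemma thetaSlope_zero : thetaSlope k 0 = deriv (theta1 k) 0 / 2 := by
  simp only [thetaSlope, dslope_same, div_eq_inv_mul _ (2 : ℂ)]
  rw [deriv_comp_mul_left, mul_zero, smul_eq_mul]

lemma thetaSlope_zero_ne_zero (hτ : 0 < (tau k).im) : thetaSlope k 0 ≠ 0 := by
  rw [thetaSlope_zero]
  exact div_ne_zero (deriv_theta1_zero_ne_zero hτ) two_ne_zero

/-- The function `ξ f₃(1 - ξ)`, extended to `ξ = 0`. -/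
def regularF3 (k : ℝ) (ξ : ℂ) : ℂ :=
  Real.pi * theta2 k 0 * theta4 k 0 / 2 * (theta3 k (ξ / 2) / thetaSlope k ξ)

lemma f3_one_sub (ξ : ℝ) : f3 k (1 - ξ) = regularF3 k ξ / ξ := by
  have half : ((1 - ξ : ℝ) : ℂ) / 2 = 1 / 2 - (ξ : ℂ) / 2 := by
    push_cast
    ring
  rw [f3, half, theta4_half_sub, theta2_half_sub, ← mul_thetaSlope, regularF3,
    mul_div_assoc (_ / 2), div_div, mul_comm (ξ : ℂ)]

lemma even_regularF3 : Function.Even (regularF3 k) := fun ξ => by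
  rw [regularF3, regularF3, even_thetaSlope, neg_div, theta3_neg]

lemma analyticAt_regularF3 (hτ : 0 < (tau k).im) : AnalyticAt ℂ (regularF3 k) 0 :=
  analyticAt_const.mul <|
    (((differentiable_theta3 hτ).comp (differentiable_id.div_const 2)).analyticAt 0).div
      ((differentiable_thetaSlope hτ).analyticAt 0) (thetaSlope_zero_ne_zero hτ)

lemma regularF3_zero (hτ : 0 < (tau k).im) : regularF3 k 0 = 1 := by
  have h := deriv_theta1_zero_ne_zero hτ
  rw [regularF3, thetaSlope_zero, zero_div, ← mul_div_assoc,
    div_eq_one_iff_eq (div_ne_zero h two_ne_zero), deriv_theta1_zero hτ]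
  ring

lemma exists_exp_halfInt (hτ : 0 < (tau k).im) :
    ∃ g : ℂ → ℂ, AnalyticAt ℂ g 0 ∧ (∀ z, g z ≠ 0) ∧ Function.Even g ∧
      ∀ᶠ ξ : ℝ in 𝓝[>] 0,
        Complex.exp (halfInt k (1 - ξ)) = ((ξ ^ (-(1 / 2) : ℝ) : ℝ) : ℂ) * g ξ := by
  have hderiv : ∀ᶠ ξ : ℝ in 𝓝[>] 0,
      HasDerivAt (fun ξ => halfInt k (1 - ξ)) (-(regularF3 k ξ / 2) / ξ) ξ := by
    filter_upwards [Ioo_mem_nhdsGT one_pos] with ξ hξ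
    refine ((hasDerivAt_halfInt hτ ⟨by linarith [hξ.2], by linarith [hξ.1]⟩).comp_const_sub 1
      ξ).congr_deriv ?_
    rw [f3_one_sub]
    ring
  obtain ⟨g, hg, hg0, hg_even, hexp⟩ := exists_exp_eq_cpow_mul
    (φ := fun ξ => -(regularF3 k ξ / 2)) (analyticAt_regularF3 hτ).div_const.neg
    (fun ξ => by simp only [even_regularF3 ξ]) hderiv
  refine ⟨g, hg, hg0, hg_even, ?_⟩
  filter_upwards [hexp, self_mem_nhdsWithin] with ξ hξ (hξ0 : 0 < ξ)
  rw [hξ, regularF3_zero hτ, Complex.ofReal_cpow hξ0.le]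
  push_cast
  rfl

end NahmData

/-! ### The solution columns near the endpoints -/

section Columns

variable {k : ℝ}

lemma gaugeC_inv (z : ℝ) : (gaugeC k z)⁻¹ =
    !![Complex.cosh (halfInt k z), -Complex.sinh (halfInt k z);
      -Complex.sinh (halfInt k z), Complex.cosh (halfInt k z)] := by
  have hdet : (gaugeC k z).det = 1 := by
    rw [gaugeC, Matrix.det_fin_two_of, ← sq, ← sq, Complex.cosh_sq_sub_sinh_sq]
  rw [Matrix.inv_def, hdet, Ring.inverse_one, one_smul, gaugeC, Matrix.adjugate_fin_two_of]

lemma orthO_mul_gaugeC_inv (z : ℝ) : orthO * (gaugeC k z)⁻¹ = (1 / (Real.sqrt 2 : ℂ)) •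
    !![Complex.exp (halfInt k z), -Complex.exp (halfInt k z);
      Complex.exp (-halfInt k z), Complex.exp (-halfInt k z)] := by
  rw [gaugeC_inv, orthO, Matrix.smul_mul, Matrix.mul_fin_two, ← Complex.cosh_add_sinh,
    ← Complex.cosh_sub_sinh]
  ring_nf

lemma inv_rpow_neg_half {ξ : ℝ} (hξ : 0 < ξ) :
    (((ξ ^ (-(1 / 2) : ℝ) : ℝ) : ℂ))⁻¹ = ((ξ ^ (-(1 / 2) : ℝ) : ℝ) : ℂ) * ξ := by
  have h : (ξ ^ (-(1 / 2) : ℝ))⁻¹ = ξ ^ (-(1 / 2) : ℝ) * ξ := by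
    rw [← Real.rpow_neg hξ.le, ← Real.rpow_add_one hξ.ne']
    norm_num
  exact_mod_cast h

lemma rpow_neg_half_mul_inv_sq {ξ : ℝ} (hξ : 0 < ξ) :
    ((ξ ^ (-(1 / 2) : ℝ) : ℝ) : ℂ) * ((ξ : ℂ) ^ 2)⁻¹ = ((ξ ^ (-(5 / 2) : ℝ) : ℝ) : ℂ) := by
  have h : ξ ^ (-(1 / 2) : ℝ) * (ξ ^ 2)⁻¹ = ξ ^ (-(5 / 2) : ℝ) := by
    rw [← Real.rpow_natCast, ← Real.rpow_neg hξ.le, ← Real.rpow_add hξ]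
    norm_num
  exact_mod_cast h

/-- The matrix `ξ^(1/2) 𝒪 C(1 - ξ)⁻¹`, where `exp (½ ∫₀^(1-ξ) f₃) = ξ^(-1/2) g(ξ)`. Written in terms
of `g`, it makes sense for complex `ξ`. -/
def gaugeFrame (g : ℂ → ℂ) (ξ : ℂ) : Matrix (Fin 2) (Fin 2) ℂ :=
  (1 / (Real.sqrt 2 : ℂ)) • !![g ξ, -g ξ; ξ / g ξ, ξ / g ξ]

variable {g : ℂ → ℂ} {ξ : ℝ}

lemma orthO_mul_gaugeC_inv_one_sub (hξ : 0 < ξ)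
    (hg : Complex.exp (halfInt k (1 - ξ)) = ((ξ ^ (-(1 / 2) : ℝ) : ℝ) : ℂ) * g ξ) :
    orthO * (gaugeC k (1 - ξ))⁻¹ = ((ξ ^ (-(1 / 2) : ℝ) : ℝ) : ℂ) • gaugeFrame g ξ := by
  rw [orthO_mul_gaugeC_inv, Complex.exp_neg, hg, mul_inv, inv_rpow_neg_half hξ, gaugeFrame,
    smul_comm]
  simp only [Matrix.smul_of, Matrix.smul_cons, Matrix.smul_empty, smul_eq_mul, mul_neg,
    div_eq_mul_inv, mul_assoc]

lemma orthO_mul_gaugeC_inv_neg_one_add (hξ : 0 < ξ) (hg_even : Function.Even g)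
    (hg : Complex.exp (halfInt k (1 - ξ)) = ((ξ ^ (-(1 / 2) : ℝ) : ℝ) : ℂ) * g ξ) :
    orthO * (gaugeC k (-1 + ξ))⁻¹ = (-((ξ ^ (-(1 / 2) : ℝ) : ℝ) : ℂ)) •
      (!![0, 1; -1, 0] * gaugeFrame g (-ξ) * !![1, 0; 0, -1]) := by
  have reflect : -1 + ξ = -(1 - ξ) := by ring
  rw [orthO_mul_gaugeC_inv, reflect, halfInt_neg, neg_neg, Complex.exp_neg, hg, mul_inv,
    inv_rpow_neg_half hξ, gaugeFrame, hg_even, Matrix.mul_smul, Matrix.smul_mul, smul_comm]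
  congr 1
  ext i j
  fin_cases i <;> fin_cases j <;> simp [div_eq_mul_inv, mul_assoc]

section Periodicity

variable (z : ℂ)

lemma theta2_add_two_div_two : theta2 k ((z + 2) / 2) = -theta2 k (z / 2) := by
  rw [← theta2_add_one, add_div, div_self two_ne_zero]

lemma theta2_sub_add_two_div_two (b : ℂ) :
    theta2 k (b - (z + 2) / 2) = -theta2 k (b - z / 2) := by
  rw [← neg_eq_iff_eq_neg, ← theta2_add_one]
  ring_nf

lemma theta4_sub_add_two_div_two (b : ℂ) :
    theta4 k (b - (z + 2) / 2) = theta4 k (b - z / 2) := by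
  rw [← theta4_add_one]
  ring_nf

lemma exp_neg_mul_eq_exp_two_mul (m : ℂ) :
    Complex.exp (-z * m) = Complex.exp (2 * m) * Complex.exp (-(z + 2) * m) := by
  rw [← Complex.exp_add]
  ring_nf

variable (aj ak al m : ℂ)

lemma colA_eq_add_two : colA k aj ak al m z = Complex.exp (2 * m) * colA k aj ak al m (z + 2) := by
  rw [colA, colA, theta2_add_two_div_two, theta2_sub_add_two_div_two, exp_neg_mul_eq_exp_two_mul]
  ring

lemma colB_eq_add_two :
    colB k aj ak al m z = -(Complex.exp (2 * m) * colB k aj ak al m (z + 2)) := by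
  rw [colB, colB, theta2_add_two_div_two, theta4_sub_add_two_div_two, exp_neg_mul_eq_exp_two_mul]
  ring

lemma colAlpha_eq_add_two :
    colAlpha k aj ak al m z = Complex.exp (2 * m) * colAlpha k aj ak al m (z + 2) := by
  rw [colAlpha, colAlpha, theta4_sub_add_two_div_two, theta4_sub_add_two_div_two,
    exp_neg_mul_eq_exp_two_mul]
  ring

lemma colBeta_eq_add_two :
    colBeta k aj ak al m z = -(Complex.exp (2 * m) * colBeta k aj ak al m (z + 2)) := by
  rw [colBeta, colBeta, theta2_sub_add_two_div_two, theta4_sub_add_two_div_two,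
    exp_neg_mul_eq_exp_two_mul]
  ring

end Periodicity

lemma one_kronecker_mulVec_apply {m n R : Type*} [Fintype m] [Fintype n] [DecidableEq m]
    [CommSemiring R] (A : Matrix n n R) (v : m × n → R) (p : m) (s : n) :
    ((1 : Matrix m m R) ⊗ₖ A).mulVec v (p, s) = A.mulVec (fun t => v (p, t)) s := by
  simp [Matrix.mulVec, dotProduct, Fintype.sum_prod_type, Matrix.one_apply]

lemma lambdaBar_eq_smul_mulVec_add_two (x₁ x₂ x₃ x₄ : ℝ) (N : ℤ) (ζ a : Fin 4 → ℂ) (i : Fin 4)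
    (z : ℂ) :
    lambdaBar k x₁ x₂ x₃ x₄ N ζ a i z = Complex.exp (2 * mu k x₁ x₂ x₃ x₄ N (ζ i) (a i)) •
      ((1 : Matrix (Fin 2) (Fin 2) ℂ) ⊗ₖ !![1, 0; 0, -1]).mulVec
        (lambdaBar k x₁ x₂ x₃ x₄ N ζ a i (z + 2)) := by
  funext ⟨p, s⟩
  rw [Pi.smul_apply, one_kronecker_mulVec_apply]
  simp only [lambdaBar, colA_eq_add_two z, colB_eq_add_two z, colAlpha_eq_add_two z,
    colBeta_eq_add_two z]
  fin_cases s
  · simp only [Fin.zero_eta, Matrix.cons_val_zero, Matrix.mulVec, Matrix.of_apply,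
      Matrix.vec2_dotProduct, Matrix.cons_val_one, Matrix.cons_val_fin_one, smul_eq_mul]
    ring
  · simp only [Fin.mk_one, Matrix.cons_val_zero, Matrix.mulVec, Matrix.of_apply,
      Matrix.vec2_dotProduct, Matrix.cons_val_one, Matrix.cons_val_fin_one, smul_eq_mul]
    ring

lemma differentiable_lambdaBar (hτ : 0 < (tau k).im) (x₁ x₂ x₃ x₄ : ℝ) (N : ℤ)
    (ζ a : Fin 4 → ℂ) (i : Fin 4) : Differentiable ℂ (lambdaBar k x₁ x₂ x₃ x₄ N ζ a i) := by
  have h2 := differentiable_theta2 hτ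
  have h4 := differentiable_theta4 hτ
  refine differentiable_pi.2 fun ⟨p, s⟩ => ?_
  fin_cases s
  · simp only [lambdaBar, colA, colAlpha, Fin.zero_eta, Matrix.cons_val_zero, div_eq_mul_inv]
    fun_prop
  · simp only [lambdaBar, colB, colBeta, Fin.mk_one, Matrix.cons_val_one, Matrix.cons_val_fin_one,
      div_eq_mul_inv]
    fun_prop

/-- The function `Φ`, analytic at `0`, for which `ξ^(-5/2) Φ(ξ)` is the value at `1 - ξ` of the
column `v̄ᵢ`, when `L` is `Λ̄ᵢ` and `exp (½ ∫₀^(1-ξ) f₃) = ξ^(-1/2) g(ξ)`. -/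
def columnGerm (k : ℝ) (g : ℂ → ℂ) (L : ℂ → Fin 2 × Fin 2 → ℂ) (ξ : ℂ) : Fin 2 × Fin 2 → ℂ :=
  ((1 : Matrix (Fin 2) (Fin 2) ℂ) ⊗ₖ gaugeFrame g ξ).mulVec
    ((thetaSlope k ξ ^ 2)⁻¹ • L (1 - ξ))

lemma analyticAt_gaugeFrame (hg : AnalyticAt ℂ g 0) (hg0 : g 0 ≠ 0) (i j : Fin 2) :
    AnalyticAt ℂ (fun ξ => gaugeFrame g ξ i j) 0 := by
  have lower : AnalyticAt ℂ (fun ξ => ξ / g ξ) 0 := analyticAt_id.div hg hg0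
  refine analyticAt_const.mul ?_
  fin_cases i <;> fin_cases j
  exacts [hg, hg.neg, lower, lower]

lemma analyticAt_columnGerm (hτ : 0 < (tau k).im) (hg : AnalyticAt ℂ g 0) (hg0 : g 0 ≠ 0)
    {L : ℂ → Fin 2 × Fin 2 → ℂ} (hL : Differentiable ℂ L) :
    AnalyticAt ℂ (columnGerm k g L) 0 := by
  have slope_analytic : AnalyticAt ℂ (fun ξ => (thetaSlope k ξ ^ 2)⁻¹) 0 :=
    (((differentiable_thetaSlope hτ).analyticAt 0).pow 2).inv
      (pow_ne_zero 2 (thetaSlope_zero_ne_zero hτ))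
  have L_analytic (p : Fin 2 × Fin 2) : AnalyticAt ℂ (fun ξ => L (1 - ξ) p) 0 :=
    ((differentiable_pi.1 hL p).comp (differentiable_id.const_sub 1)).analyticAt 0
  refine AnalyticAt.pi fun p => ?_
  simp only [columnGerm, Matrix.mulVec, dotProduct]
  refine Finset.analyticAt_fun_sum _ fun q _ => ?_
  exact (analyticAt_const.mul (analyticAt_gaugeFrame hg hg0 _ _)).mul
    (slope_analytic.mul (L_analytic q))

lemma vBar_one_sub (x₁ x₂ x₃ x₄ : ℝ) (N : ℤ) (ζ a : Fin 4 → ℂ) (i : Fin 4) (hξ : 0 < ξ)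
    (hg : Complex.exp (halfInt k (1 - ξ)) = ((ξ ^ (-(1 / 2) : ℝ) : ℝ) : ℂ) * g ξ) :
    vBar k x₁ x₂ x₃ x₄ N ζ a i (1 - ξ) =
      ((ξ ^ (-(5 / 2) : ℝ) : ℝ) : ℂ) • columnGerm k g (lambdaBar k x₁ x₂ x₃ x₄ N ζ a i) ξ := by
  rw [vBar, orthO_mul_gaugeC_inv_one_sub hξ hg, Complex.ofReal_sub, Complex.ofReal_one,
    theta2_one_sub_div_two, one_div (_ ^ 2), mul_pow, mul_inv, mul_smul, Matrix.kronecker_smul,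
    Matrix.smul_mulVec, Matrix.mulVec_smul, smul_smul, rpow_neg_half_mul_inv_sq hξ, columnGerm]

lemma vBar_neg_one_add (x₁ x₂ x₃ x₄ : ℝ) (N : ℤ) (ζ a : Fin 4 → ℂ) (i : Fin 4) (hξ : 0 < ξ)
    (hg_even : Function.Even g)
    (hg : Complex.exp (halfInt k (1 - ξ)) = ((ξ ^ (-(1 / 2) : ℝ) : ℝ) : ℂ) * g ξ) :
    vBar k x₁ x₂ x₃ x₄ N ζ a i (-1 + ξ) = ((ξ ^ (-(5 / 2) : ℝ) : ℝ) : ℂ) •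
      (-Complex.exp (2 * mu k x₁ x₂ x₃ x₄ N (ζ i) (a i))) •
        matU.mulVec (columnGerm k g (lambdaBar k x₁ x₂ x₃ x₄ N ζ a i) (-ξ)) := by
  have sq_signs : (!![1, 0; 0, -1] : Matrix (Fin 2) (Fin 2) ℂ) * !![1, 0; 0, -1] = 1 := by
    simp [Matrix.one_fin_two]
  have theta2_eq : theta2 k (((-1 + ξ : ℝ) : ℂ) / 2) = ξ * thetaSlope k (-ξ) := by
    rw [even_thetaSlope, ← theta2_one_sub_div_two, ← theta2_neg]
    push_cast
    ring_nf
  have arg_add_two : ((-1 + ξ : ℝ) : ℂ) + 2 = 1 - -ξ := by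
    push_cast
    ring
  have frame_mul : (1 : Matrix (Fin 2) (Fin 2) ℂ) ⊗ₖ
        (!![0, 1; -1, 0] * gaugeFrame g (-ξ) * !![1, 0; 0, -1]) *
          (1 : Matrix (Fin 2) (Fin 2) ℂ) ⊗ₖ !![1, 0; 0, -1] =
      matU * (1 : Matrix (Fin 2) (Fin 2) ℂ) ⊗ₖ gaugeFrame g (-ξ) := by
    rw [matU, ← Matrix.mul_kronecker_mul, ← Matrix.mul_kronecker_mul, mul_assoc, sq_signs, mul_one,
      mul_one]
  rw [vBar, orthO_mul_gaugeC_inv_neg_one_add hξ hg_even hg, theta2_eq,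
    lambdaBar_eq_smul_mulVec_add_two, arg_add_two, columnGerm, Matrix.mulVec_mulVec, ← frame_mul,
    ← rpow_neg_half_mul_inv_sq hξ]
  simp only [Matrix.kronecker_smul, Matrix.smul_mul, Matrix.smul_mulVec, Matrix.mulVec_smul,
    Matrix.mulVec_mulVec, smul_smul]
  congr 1
  rw [mul_pow, one_div, mul_inv]
  ring

end Columns

end Monopole

end

open Monopole in
theorem theorem7p3_general {k : ℝ} (hk0 : 0 < k) (hk1 : k < 1) (x₁ x₂ x₃ x₄ : ℝ) (N : ℤ)
    (ζ a : Fin 4 → ℂ) (i : Fin 4) :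
    (∃! c, HasPoleExpansion (fun ξ => vBar k x₁ x₂ x₃ x₄ N ζ a i (1 - ξ)) c) ∧
    ∀ c, HasPoleExpansion (fun ξ => vBar k x₁ x₂ x₃ x₄ N ζ a i (1 - ξ)) c →
      HasPoleExpansion (fun ξ => vBar k x₁ x₂ x₃ x₄ N ζ a i (-1 + ξ)) fun s =>
        -((-1 : ℂ) ^ s * Complex.exp (2 * mu k x₁ x₂ x₃ x₄ N (ζ i) (a i))) • matU.mulVec (c s) := by
  have hτ := tau_im_pos hk0 hk1
  obtain ⟨g, hg, hg0, hg_even, exp_halfInt⟩ := exists_exp_halfInt hτ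
  let Φ := columnGerm k g (lambdaBar k x₁ x₂ x₃ x₄ N ζ a i)
  have hΦ : AnalyticAt ℂ Φ 0 :=
    analyticAt_columnGerm hτ hg (hg0 0) (differentiable_lambdaBar hτ x₁ x₂ x₃ x₄ N ζ a i)
  have at_one : ∀ᶠ ξ : ℝ in 𝓝[>] 0, vBar k x₁ x₂ x₃ x₄ N ζ a i (1 - ξ) =
      ((ξ ^ (-(5 / 2) : ℝ) : ℝ) : ℂ) • Φ ξ := by
    filter_upwards [exp_halfInt, self_mem_nhdsWithin] with ξ hgξ hξ
    exact vBar_one_sub x₁ x₂ x₃ x₄ N ζ a i hξ hgξ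
  have at_neg_one : ∀ᶠ ξ : ℝ in 𝓝[>] 0, vBar k x₁ x₂ x₃ x₄ N ζ a i (-1 + ξ) =
      ((ξ ^ (-(5 / 2) : ℝ) : ℝ) : ℂ) • (-Complex.exp (2 * mu k x₁ x₂ x₃ x₄ N (ζ i) (a i))) •
        matU.mulVec (Φ (-ξ)) := by
    filter_upwards [exp_halfInt, self_mem_nhdsWithin] with ξ hgξ hξ
    exact vBar_neg_one_add x₁ x₂ x₃ x₄ N ζ a i hξ hg_even hgξ
  refine ⟨?_, fun c hc => hc.comp_neg_smul_mulVec hΦ at_one at_neg_one⟩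
  obtain ⟨p, hp⟩ := hΦ
  simp only [hasPoleExpansion_iff_eq_coeff hp at_one, existsUnique_eq]

theorem theorem7p3 (k : ℝ) (hk0 : 0 < k) (hk1 : k < 1) (x₁ x₂ x₃ x₄ : ℝ)
    (ζ η : Fin 4 → ℂ) (hP : Monopole.IsAtiyahWardSolution k x₁ x₂ x₃ ζ η)
    (a : Fin 4 → ℂ) (ha : ∀ j, Monopole.IsAbelImage k (ζ j) (η j) (a j))
    (N : ℤ) (hN : ∑ j, a j = N * Monopole.tau k) (i : Fin 4) :
    (∃! c : ℕ → Fin 2 × Fin 2 → ℂ, Monopole.HasPoleExpansion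
      (fun ξ => Monopole.vBar k x₁ x₂ x₃ x₄ N ζ a i (1 - ξ)) c) ∧
    ∀ c : ℕ → Fin 2 × Fin 2 → ℂ,
      Monopole.HasPoleExpansion (fun ξ => Monopole.vBar k x₁ x₂ x₃ x₄ N ζ a i (1 - ξ)) c →
      Monopole.HasPoleExpansion (fun ξ => Monopole.vBar k x₁ x₂ x₃ x₄ N ζ a i (-1 + ξ))
        (fun s => -((-1 : ℂ) ^ s *
          Complex.exp (2 * Monopole.mu k x₁ x₂ x₃ x₄ N (ζ i) (a i))) •
            Monopole.matU.mulVec (c s)) :=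
  theorem7p3_general hk0 hk1 x₁ x₂ x₃ x₄ N ζ a i
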